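/- For a subspace $U$ of $\mathbb R^n$ (with the Euclidean norm) let $P_U$ be the orthogonal projection onto $U$. Families $\{(V_k,1)\}_{k=1}^m$ and $\{(W_k,1)\}_{k=1}^m$ of subspaces of $\mathbb R^n$ are called uniform tight weaving fusion frames for $\mathbb R^n$ if there is a constant $A>0$ such that for every $\sigma\subset\{1,\dots,m\}$ and every $f\in\mathbb R^n$ $$\sum_{k\in\sigma}\|P_{V_k}f\|^2+\sum_{k\in\sigma^c}\|P_{W_k}f\|^2=A\|f\|^2 .$$ For $\sigma\subset\{1,\dots,m\}$ let $S_\sigma f=\sum_{k\in\sigma}P_{V_k}f+\sum_{k\in\sigma^c}P_{W_k}f$ be the weaving fusion frame operator. Let $\delta_1,\dots,\delta_m$ be independent random variables taking the values $1$ (measurement received) and $0$ (measurement erased) with probability $\tfrac12$ each, and let $$\hat f=2\,S_\sigma^{-1}\Big(\sum_{k\in\sigma}\delta_kP_{V_k}f+\sum_{k\in\sigma^c}\delta_kP_{W_k}f\Big)$$ be the reconstruction of $f$ from the weaving given by $\sigma$ after erasures. **Theorem 4.1 (probabilistic erasure).** There is an absolute constant $M>0$ with the following property. Let $n\ge 2$,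 let $\{(V_k,1)\}_{k=1}^m$ and $\{(W_k,1)\}_{k=1}^m$ be uniform tight weaving fusion frames for $\mathbb R^n$ all of whose subspaces $V_k$, $W_k$ are nonzero, and let $\varepsilon>0$ satisfy $\varepsilon^2\ge\frac nm\log n$. Then for every $\sigma\subset\{1,\dots,m\}$ and every $f\in\mathbb R^n$, the random variable $\|\hat f-f\|$ is integrable and $$\mathbb E\,\|\hat f-f\|\le M\,\varepsilon\,\|f\| .$$ -/

import Mathlib

open MeasureTheory ProbabilityTheory

noncomputable section

namespace WeavingFusion

variable {H : Type*} [NormedAddCommGroup H] [InnerProductSpace ℝ H] [FiniteDimensional ℝ H]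
variable {ι : Type*} [Fintype ι] [DecidableEq ι]

/-- The weighted family `(V i, v i)` of subspaces of `H` satisfies the fusion frame inequality
with bounds `A` and `B`; here `(V i).starProjection` is the orthogonal projection onto `V i`. -/
def HasFusionBounds (V : ι → Submodule ℝ H) (v : ι → ℝ) (A B : ℝ) : Prop :=
  ∀ f : H, A * ‖f‖ ^ 2 ≤ ∑ i, v i ^ 2 * ‖(V i).starProjection f‖ ^ 2 ∧
    ∑ i, v i ^ 2 * ‖(V i).starProjection f‖ ^ 2 ≤ B * ‖f‖ ^ 2

/-- Fusion frames indexed by a finite set. -/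
def IsFusionFrame (V : ι → Submodule ℝ H) (v : ι → ℝ) : Prop :=
  ∃ A B : ℝ, 0 < A ∧ A ≤ B ∧ HasFusionBounds V v A B

/-- The fusion frame operator `f ↦ ∑ i, v i ^ 2 • P_{V i} f`. -/
def frameOperator (V : ι → Submodule ℝ H) (v : ι → ℝ) : H →L[ℝ] H :=
  ∑ i, v i ^ 2 • (V i).starProjection

/-- Two fusion frames are weaving with universal bounds `A` and `B`: for every set `σ` of
indices, taking `(V i, v i)` for `i ∈ σ` and `(W i, w i)` for `i ∉ σ` gives a fusion frame with
bounds `A` and `B`. -/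
structure IsWeavingWith (V : ι → Submodule ℝ H) (v : ι → ℝ) (W : ι → Submodule ℝ H) (w : ι → ℝ)
    (A B : ℝ) : Prop where
  left : IsFusionFrame V v
  right : IsFusionFrame W w
  pos : 0 < A
  le : A ≤ B
  bounds : ∀ σ : Finset ι, HasFusionBounds (σ.piecewise V W) (σ.piecewise v w) A B

/-- Uniform tight weaving fusion frames: all weavings are tight, with one common bound. -/
def IsUniformTightWeaving (V : ι → Submodule ℝ H) (v : ι → ℝ) (W : ι → Submodule ℝ H)
    (w : ι → ℝ) : Prop :=
  ∃ A : ℝ, IsWeavingWith V v W w A A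

/-- Reconstruction of `f` from the measurements of the weaving given by `σ` after erasures.
The `i`-th measurement is multiplied by `d i` (which is `1` if it is received and `0` if it is
lost) and the fusion frame reconstruction formula `S⁻¹ ∑ i, u i ^ 2 • P_{U i} f` of the weaving
is applied; the factor `2` is the reciprocal of the probability `1 / 2` of reception. -/
def reconstruction (V : ι → Submodule ℝ H) (v : ι → ℝ) (W : ι → Submodule ℝ H) (w : ι → ℝ)
    (σ : Finset ι) (d : ι → ℝ) (f : H) : H :=
  (2 : ℝ) • (frameOperator (σ.piecewise V W) (σ.piecewise v w)).inverse
    (∑ i ∈ σ, (d i * v i ^ 2) • (V i).starProjection f +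
      ∑ i ∈ σᶜ, (d i * w i ^ 2) • (W i).starProjection f)

/-- The variables `d i` are independent and take the values `1` and `0` with probability `1 / 2`
each. -/
structure IsBernoulliErasure {Ω : Type*} [MeasurableSpace Ω] (μ : Measure Ω)
    (d : ι → Ω → ℝ) : Prop where
  measurable : ∀ i, Measurable (d i)
  indep : iIndepFun d μ
  prob_one : ∀ i, μ {ω | d i ω = 1} = 1 / 2
  prob_zero : ∀ i, μ {ω | d i ω = 0} = 1 / 2

end WeavingFusion

end

namespace WeavingFusion

section Frames

variable {H : Type*} [NormedAddCommGroup H] [InnerProductSpace ℝ H]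

/-! A second-moment argument suffices. Tightness makes the frame operator `A • id`, so the error is
`A⁻¹ ∑ sᵢ Pᵢ f` with independent mean-zero signs `sᵢ = 2 dᵢ - 1` (`reconstruction_sub_eq`).
Orthogonality of the signs gives it mean square `A⁻² ∑ ‖Pᵢ f‖² = A⁻¹ ‖f‖²`, hence mean norm at most
`A^(-1/2) ‖f‖`. Taking traces, each nonzero subspace contributes at least 1, so `m ≤ A n` and `A⁻¹ ≤
n / m`. The logarithm enters only through a positive lower bound for `log n`. -/

theorem inverse_smul_id {A : ℝ} (hA : A ≠ 0) :
    (A • ContinuousLinearMap.id ℝ H).inverse = A⁻¹ • ContinuousLinearMap.id ℝ H :=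
  ContinuousLinearMap.inverse_eq (by ext x; simp [smul_smul, hA]) (by ext x; simp [smul_smul, hA])

variable [FiniteDimensional ℝ H] {ι : Type*} [Fintype ι]

/-- A tight fusion frame with unit weights has a scalar frame operator. -/
theorem frameOperator_eq_smul_id {U : ι → Submodule ℝ H} {A : ℝ}
    (hU : ∀ f : H, ∑ i, ‖(U i).starProjection f‖ ^ 2 = A * ‖f‖ ^ 2) :
    frameOperator U (fun _ => 1) = A • ContinuousLinearMap.id ℝ H := by
  have hsym : ((frameOperator U (fun _ => 1) - A • ContinuousLinearMap.id ℝ H :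
      H →L[ℝ] H) : H →ₗ[ℝ] H).IsSymmetric := by
    intro x y
    simp [frameOperator, inner_sub_left, inner_sub_right, sum_inner, inner_sum,
      Submodule.inner_starProjection_left_eq_right, inner_smul_left, inner_smul_right]
  -- By polarization, a symmetric operator with zero quadratic form vanishes.
  have hzero := hsym.inner_map_self_eq_zero.mp (fun x => by
    simp only [frameOperator, ContinuousLinearMap.coe_coe, sub_apply,
      sum_apply, one_pow, one_smul, smul_apply,
      ContinuousLinearMap.id_apply, inner_sub_left, sum_inner, inner_smul_left,
      real_inner_self_eq_norm_sq, RCLike.conj_to_real]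
    rw [sub_eq_zero, ← hU x]
    refine Finset.sum_congr rfl fun i _ => ?_
    rw [← real_inner_self_eq_norm_sq, Submodule.inner_starProjection_left_eq_right,
      Submodule.inner_starProjection_left_eq_right,
      Submodule.starProjection_eq_self_iff.mpr (Submodule.starProjection_apply_mem _ _)])
  ext x
  exact sub_eq_zero.mp (LinearMap.congr_fun hzero x)

/-- The sum is the trace of the projection. For nonzero `v ∈ U`, Parseval for `v` and Cauchy–Schwarz
applied to `⟪e j, v⟫ = ⟪P (e j), v⟫` bound it below without computing the dimension. -/
theorem one_le_sum_sq_norm_starProjection {κ : Type*} [Fintype κ] (e : OrthonormalBasis κ ℝ H)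
    {U : Submodule ℝ H} (hU : U ≠ ⊥) : 1 ≤ ∑ j, ‖U.starProjection (e j)‖ ^ 2 := by
  obtain ⟨v, hv, hv0⟩ := U.exists_mem_ne_zero_of_ne_bot hU
  have hpos : 0 < ‖v‖ ^ 2 := by positivity
  refine le_of_mul_le_mul_right ?_ hpos
  rw [one_mul, Finset.sum_mul, ← e.sum_sq_norm_inner_right v]
  refine Finset.sum_le_sum fun j _ => ?_
  rw [e.sum_sq_norm_inner_right v, ← mul_pow]
  refine pow_le_pow_left₀ (norm_nonneg _) ?_ 2
  have : inner ℝ (e j) v = inner ℝ (U.starProjection (e j)) v := by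
    rw [Submodule.inner_starProjection_left_eq_right, Submodule.starProjection_eq_self_iff.mpr hv]
  rw [this]
  exact norm_inner_le_norm _ _

/-- The bound of a tight fusion frame of nonzero subspaces is at least its redundancy. -/
theorem card_le_tight_bound_mul_finrank {U : ι → Submodule ℝ H} {A : ℝ}
    (hU : ∀ f : H, ∑ i, ‖(U i).starProjection f‖ ^ 2 = A * ‖f‖ ^ 2) (h0 : ∀ i, U i ≠ ⊥) :
    (Fintype.card ι : ℝ) ≤ A * Module.finrank ℝ H := by
  let e := stdOrthonormalBasis ℝ H
  calc (Fintype.card ι : ℝ) = ∑ _i : ι, (1 : ℝ) := by simp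
    _ ≤ ∑ i, ∑ j, ‖(U i).starProjection (e j)‖ ^ 2 :=
        Finset.sum_le_sum fun i _ => one_le_sum_sq_norm_starProjection e (h0 i)
    _ = ∑ j, ∑ i, ‖(U i).starProjection (e j)‖ ^ 2 := Finset.sum_comm
    _ = A * Module.finrank ℝ H := by simp [hU, mul_comm]

variable [DecidableEq ι]

/-- The reconstruction error of a tight weaving is a signed sum of the measurements. -/
theorem reconstruction_sub_eq {V W : ι → Submodule ℝ H} {σ : Finset ι} {A : ℝ} (hA : A ≠ 0)
    (hU : ∀ f : H, ∑ i, ‖(σ.piecewise V W i).starProjection f‖ ^ 2 = A * ‖f‖ ^ 2)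
    (d : ι → ℝ) (f : H) :
    reconstruction V (fun _ => 1) W (fun _ => 1) σ d f - f =
      A⁻¹ • ∑ i, (2 * d i - 1) • (σ.piecewise V W i).starProjection f := by
  have hS := frameOperator_eq_smul_id hU
  have hf : A⁻¹ • ∑ i, (σ.piecewise V W i).starProjection f = f := by
    have := congrArg (fun T : H →L[ℝ] H => A⁻¹ • T f) hS
    simpa [frameOperator, smul_smul, hA] using this
  have hsum : ∑ i ∈ σ, (d i * (1 : ℝ) ^ 2) • (V i).starProjection f +
      ∑ i ∈ σᶜ, (d i * (1 : ℝ) ^ 2) • (W i).starProjection f =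
      ∑ i, d i • (σ.piecewise V W i).starProjection f := by
    rw [← Finset.sum_add_sum_compl σ]
    refine congrArg₂ _ (Finset.sum_congr rfl fun i hi => ?_) (Finset.sum_congr rfl fun i hi => ?_)
    · simp [Finset.piecewise_eq_of_mem _ _ _ hi]
    · simp [Finset.piecewise_eq_of_notMem _ _ _ (Finset.mem_compl.mp hi)]
  rw [reconstruction, hsum, Finset.piecewise_same, hS, inverse_smul_id hA]
  -- Expanding the subtracted `f` in the frame turns the coefficients `2 * d i` into signs.
  nth_rewrite 2 [← hf]
  simp only [sub_smul, Finset.sum_sub_distrib, one_smul, mul_smul, smul_sub, ← Finset.smul_sum,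
    smul_apply, ContinuousLinearMap.id_apply]
  rw [smul_comm]

end Frames

section Signs

variable {ι : Type*} {Ω : Type*} [MeasurableSpace Ω] {μ : Measure Ω} {d : ι → Ω → ℝ}

theorem IsBernoulliErasure.measurable_sign (hd : IsBernoulliErasure μ d) (i : ι) :
    Measurable fun ω => 2 * d i ω - 1 :=
  ((hd.measurable i).const_mul 2).sub_const 1

variable [IsProbabilityMeasure μ]

theorem IsBernoulliErasure.ae_eq_or (hd : IsBernoulliErasure μ d) (i : ι) :
    ∀ᵐ ω ∂μ, d i ω = 1 ∨ d i ω = 0 := by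
  have h1 : MeasurableSet {ω | d i ω = 1} := hd.measurable i (measurableSet_singleton 1)
  have h0 : MeasurableSet {ω | d i ω = 0} := hd.measurable i (measurableSet_singleton 0)
  have hdisj : Disjoint {ω | d i ω = 1} {ω | d i ω = 0} := by
    rw [Set.disjoint_left]
    intro ω h h'
    exact one_ne_zero (h.symm.trans h')
  have hunion : μ ({ω | d i ω = 1} ∪ {ω | d i ω = 0}) = 1 := by
    rw [measure_union hdisj h0, hd.prob_one, hd.prob_zero, ENNReal.add_halves]
  exact (prob_compl_eq_zero_iff (h1.union h0)).mpr hunion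

theorem IsBernoulliErasure.ae_sign_sq (hd : IsBernoulliErasure μ d) (i : ι) :
    ∀ᵐ ω ∂μ, (2 * d i ω - 1) * (2 * d i ω - 1) = 1 := by
  filter_upwards [hd.ae_eq_or i] with ω hω
  rcases hω with h | h <;> norm_num [h]

theorem IsBernoulliErasure.ae_norm_sign_le (hd : IsBernoulliErasure μ d) (i : ι) :
    ∀ᵐ ω ∂μ, ‖2 * d i ω - 1‖ ≤ 1 := by
  filter_upwards [hd.ae_eq_or i] with ω hω
  rcases hω with h | h <;> norm_num [h]

theorem IsBernoulliErasure.integral_sign (hd : IsBernoulliErasure μ d) (i : ι) :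
    ∫ ω, (2 * d i ω - 1) ∂μ = 0 := by
  have h1 : MeasurableSet {ω | d i ω = 1} := hd.measurable i (measurableSet_singleton 1)
  have heq : d i =ᵐ[μ] {ω | d i ω = 1}.indicator 1 := by
    filter_upwards [hd.ae_eq_or i] with ω hω
    rcases hω with h | h <;> simp [Set.indicator, h]
  have hint : ∫ ω, d i ω ∂μ = 1 / 2 := by
    rw [integral_congr_ae heq, integral_indicator_one h1, measureReal_def, hd.prob_one]
    simp
  have hI : Integrable (d i) μ :=
    ((integrable_const (1 : ℝ)).indicator h1).congr heq.symm
  rw [integral_sub (hI.const_mul 2) (integrable_const _), integral_const_mul, hint]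
  simp

theorem IsBernoulliErasure.integrable_sign_mul (hd : IsBernoulliErasure μ d) (i j : ι) :
    Integrable (fun ω => (2 * d i ω - 1) * (2 * d j ω - 1)) μ := by
  refine Integrable.of_bound
    ((hd.measurable_sign i).mul (hd.measurable_sign j)).aestronglyMeasurable 1 ?_
  filter_upwards [hd.ae_norm_sign_le i, hd.ae_norm_sign_le j] with ω hi hj
  rw [norm_mul]
  exact mul_le_one₀ hi (norm_nonneg _) hj

theorem IsBernoulliErasure.integral_sign_mul [DecidableEq ι] (hd : IsBernoulliErasure μ d) (i j : ι) :
    ∫ ω, (2 * d i ω - 1) * (2 * d j ω - 1) ∂μ = if i = j then 1 else 0 := by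
  split_ifs with hij
  · subst hij
    rw [integral_congr_ae (hd.ae_sign_sq i)]
    simp
  · have hmeas : Measurable fun x : ℝ => 2 * x - 1 := by fun_prop
    have hind := (hd.indep.indepFun hij).comp hmeas hmeas
    have := hind.integral_fun_mul_eq_mul_integral
      (hd.measurable_sign i).aestronglyMeasurable (hd.measurable_sign j).aestronglyMeasurable
    simp only [Function.comp_apply] at this
    rw [this, hd.integral_sign, zero_mul]

variable {H : Type*} [NormedAddCommGroup H] [InnerProductSpace ℝ H] [Fintype ι]

theorem norm_sum_smul_sq (c : ι → ℝ) (x : ι → H) :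
    ‖∑ i, c i • x i‖ ^ 2 = ∑ i, ∑ j, c i * c j * inner ℝ (x i) (x j) := by
  rw [← real_inner_self_eq_norm_sq, sum_inner]
  simp_rw [inner_sum, real_inner_smul_left, real_inner_smul_right, mul_assoc]

theorem IsBernoulliErasure.integrable_norm_sum_sq (hd : IsBernoulliErasure μ d) (x : ι → H) :
    Integrable (fun ω => ‖∑ i, (2 * d i ω - 1) • x i‖ ^ 2) μ := by
  simp_rw [norm_sum_smul_sq]
  exact integrable_finsetSum _ fun i _ => integrable_finsetSum _ fun j _ =>
    (hd.integrable_sign_mul i j).mul_const _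

/-- Orthogonality of random signs. -/
theorem IsBernoulliErasure.integral_norm_sum_sq (hd : IsBernoulliErasure μ d) (x : ι → H) :
    ∫ ω, ‖∑ i, (2 * d i ω - 1) • x i‖ ^ 2 ∂μ = ∑ i, ‖x i‖ ^ 2 := by
  classical
  simp_rw [norm_sum_smul_sq]
  rw [integral_finsetSum _ fun i _ => integrable_finsetSum _ fun j _ =>
    (hd.integrable_sign_mul i j).mul_const _]
  refine Finset.sum_congr rfl fun i _ => ?_
  rw [integral_finsetSum _ fun j _ => (hd.integrable_sign_mul i j).mul_const _]
  simp_rw [integral_mul_const, hd.integral_sign_mul]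
  simp

theorem IsBernoulliErasure.memLp_norm_sum (hd : IsBernoulliErasure μ d) (x : ι → H) :
    MemLp (fun ω => ‖∑ i, (2 * d i ω - 1) • x i‖) 2 μ := by
  refine (memLp_two_iff_integrable_sq ?_).mpr (hd.integrable_norm_sum_sq x)
  refine (Finset.aestronglyMeasurable_fun_sum _ fun i _ => ?_).norm
  exact (hd.measurable_sign i).aestronglyMeasurable.smul_const _

theorem IsBernoulliErasure.sq_integral_norm_sum_le (hd : IsBernoulliErasure μ d) (x : ι → H) :
    (∫ ω, ‖∑ i, (2 * d i ω - 1) • x i‖ ∂μ) ^ 2 ≤ ∑ i, ‖x i‖ ^ 2 := by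
  -- Nonnegative variance is the inequality `(E X)² ≤ E X²`.
  have h := variance_nonneg (fun ω => ‖∑ i, (2 * d i ω - 1) • x i‖) μ
  rw [variance_eq_sub (hd.memLp_norm_sum x)] at h
  have h' := hd.integral_norm_sum_sq x
  simp only [Pi.pow_apply] at h
  linarith

end Signs

end WeavingFusion

open WeavingFusion in
theorem theorem4p1 :
    ∃ M : ℝ, 0 < M ∧
      ∀ (n m : ℕ), 2 ≤ n →
      ∀ (V W : Fin m → Submodule ℝ (EuclideanSpace ℝ (Fin n))),
        WeavingFusion.IsUniformTightWeaving V (fun _ => 1) W (fun _ => 1) →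
        (∀ k, V k ≠ ⊥) → (∀ k, W k ≠ ⊥) →
      ∀ ε : ℝ, 0 < ε → (n : ℝ) / (m : ℝ) * Real.log (n : ℝ) ≤ ε ^ 2 →
      ∀ (Ω : Type*) [MeasurableSpace Ω] (μ : Measure Ω) [IsProbabilityMeasure μ]
        (d : Fin m → Ω → ℝ), WeavingFusion.IsBernoulliErasure μ d →
      ∀ (σ : Finset (Fin m)) (f : EuclideanSpace ℝ (Fin n)),
        Integrable (fun ω => ‖WeavingFusion.reconstruction V (fun _ => 1) W (fun _ => 1) σ
          (fun k => d k ω) f - f‖) μ ∧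
        ∫ ω, ‖WeavingFusion.reconstruction V (fun _ => 1) W (fun _ => 1) σ
          (fun k => d k ω) f - f‖ ∂μ ≤ M * ε * ‖f‖ := by
  refine ⟨2, two_pos, ?_⟩
  intro n m hn V W ⟨A, hVW⟩ hV hW ε hε hεnm Ω _ μ _ d hd σ f
  have hA := hVW.pos
  have hU : ∀ g : EuclideanSpace ℝ (Fin n),
      ∑ i, ‖(σ.piecewise V W i).starProjection g‖ ^ 2 = A * ‖g‖ ^ 2 := by
    intro g
    have h := hVW.bounds σ g
    simp only [Finset.piecewise_same, one_pow, one_mul] at h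
    exact le_antisymm h.2 h.1
  have h0 : ∀ i, σ.piecewise V W i ≠ ⊥ := fun i =>
    Finset.piecewise_cases σ V W (fun U => U ≠ ⊥) (hV i) (hW i)
  have hcard := card_le_tight_bound_mul_finrank hU h0
  rw [Fintype.card_fin, finrank_euclideanSpace_fin] at hcard
  simp_rw [reconstruction_sub_eq hA.ne' hU, norm_smul]
  have hLp := hd.memLp_norm_sum fun i => (σ.piecewise V W i).starProjection f
  refine ⟨(hLp.integrable one_le_two).const_mul _, ?_⟩
  have hsq := hd.sq_integral_norm_sum_le fun i => (σ.piecewise V W i).starProjection f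
  rw [hU f] at hsq
  -- For `m = 0` the quotient `n / m` is 0 and the hypothesis on `ε` says nothing; tightness with `A
  -- > 0` excludes this case.
  have hm : 0 < (m : ℝ) := by
    rcases Nat.eq_zero_or_pos m with rfl | hm
    · have : Nontrivial (EuclideanSpace ℝ (Fin n)) :=
        Module.nontrivial_of_finrank_pos (R := ℝ) (by rw [finrank_euclideanSpace_fin]; omega)
      obtain ⟨g, hg⟩ := exists_ne (0 : EuclideanSpace ℝ (Fin n))
      have h := hU g
      rw [Finset.univ_eq_empty, Finset.sum_empty] at h
      have : 0 < A * ‖g‖ ^ 2 := by positivity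
      exact absurd h this.ne
    · exact_mod_cast hm
  have hn' : (2 : ℝ) ≤ n := by exact_mod_cast hn
  -- The crude bound `1 / 4` is a perfect square below `log 2`; it yields `A⁻¹ ≤ 4 ε²`, whence the
  -- constant 2.
  have hlog : 1 / 4 ≤ Real.log n :=
    le_trans (by linarith [Real.log_two_gt_d9]) (Real.log_le_log two_pos hn')
  have hinv : A⁻¹ ≤ (2 * ε) ^ 2 := by
    have h1 : A⁻¹ ≤ n / m := by
      rw [inv_le_iff_one_le_mul₀ hA, div_mul_eq_mul_div, one_le_div hm]
      linarith
    have h2 : (n : ℝ) / m * (1 / 4) ≤ n / m * Real.log n :=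
      mul_le_mul_of_nonneg_left hlog (by positivity)
    linarith
  rw [integral_const_mul]
  refine abs_le_of_sq_le_sq ?_ (by positivity) |> le_of_abs_le
  rw [mul_pow, mul_pow, norm_inv, Real.norm_of_nonneg hA.le]
  calc A⁻¹ ^ 2 * (∫ ω, ‖∑ i, (2 * d i ω - 1) • (σ.piecewise V W i).starProjection f‖ ∂μ) ^ 2
      ≤ A⁻¹ ^ 2 * (A * ‖f‖ ^ 2) := mul_le_mul_of_nonneg_left hsq (by positivity)
    _ = A⁻¹ * ‖f‖ ^ 2 := by field_simp
    _ ≤ (2 * ε) ^ 2 * ‖f‖ ^ 2 := mul_le_mul_of_nonneg_right hinv (by positivity)
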